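/- Work over $\mathbb C$. Let $\mathcal A$ be the Lie algebra with basis $Z_n=\frac{x^{n+1}}{(n+1)!}\frac{\partial}{\partial x}$, $n\ge -1$, of vector fields on the line with polynomial coefficients, and let $\mathcal A^1\subset\mathcal A$ be the Lie subalgebra spanned by the $Z_n$ with $n\ge 1$ (the fields vanishing to order $2$ at $0$). Let $\mathcal H^1=\mathbb C[\delta_1,\delta_2,\dots]$ be the bialgebra with counit $\varepsilon(P)=P(0)$ whose coproduct is the algebra homomorphism determined by $\Delta\delta_1=\delta_1\otimes 1+1\otimes\delta_1$ and $\Delta\delta_{n+1}=[X\otimes 1+1\otimes X+\delta_1\otimes Y,\ \Delta\delta_n]$, where $[X,\cdot]$ and $[Y,\cdot]$ are the derivations of $\mathcal H^1$ with $[X,\delta_n]=\delta_{n+1}$ and $[Y,\delta_n]=n\,\delta_n$, and $[\delta_1\otimes Y,\,P\otimes Q]=\delta_1P\otimes[Y,Q]$. Let $\langle\cdot,\cdot\rangle:\mathcal H^1\times U(\mathcal A^1)\to\mathbb C$ be the pairing determined by $\langle P,1\rangle=\varepsilon(P)$, $\langle P,Z_k\rangle=\frac{\partial P}{\partial\delta_k}(0)$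 for $k\ge 1$, and $\langle P,ab\rangle=\langle\Delta P,a\otimes b\rangle$. Let $L_0$ be the linear form on $U(\mathcal A)$ that picks out the coefficient of $Z_0$ in the basis of ordered monomials $Z_n^{a_n}\cdots Z_1^{a_1}Z_0^{a_0}Z_{-1}^{a_{-1}}$, that is, $L_0(Z_0)=1$ and $L_0$ vanishes on every other ordered monomial. Then for every integer $n\ge 1$ and every $a\in U(\mathcal A^1)\subset U(\mathcal A)$, $$\langle\delta_n,a\rangle = L_0\big(\underbrace{[Z_{-1},[Z_{-1},\dots,[Z_{-1}}_{n\ \text{times}},a]\dots]]\big).$$ -/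

import Mathlib

namespace ConnesMoscovici

noncomputable section

open scoped TensorProduct

attribute [local instance 100] LieRing.ofAssociativeRing
section
open Polynomial
/-- The Lie algebra `𝒜` of vector fields `f(x) ∂/∂x` on the line, with polynomial `f`: it is the
linear span of the `Z_n = x^(n+1)/(n+1)! ∂/∂x`, `n ≥ -1`, with the commutator bracket. -/
abbrev VF : Type := Derivation ℂ ℂ[X] ℂ[X]

/-- `vf k = x^k/k! ∂/∂x` is the basis element `Z_{k-1}` of `𝒜`: thus `vf 0 = Z_{-1} = ∂/∂x`,
`vf 1 = Z_0 = x ∂/∂x`, and `vf (n + 1) = Z_n`. -/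
def vf (k : ℕ) : VF := Polynomial.mkDerivation ℂ (Polynomial.C ((k.factorial : ℂ)⁻¹) * Polynomial.X ^ k)

theorem VF.apply_eq (v : VF) (p : ℂ[X]) : v p = derivative p * v X := by
  have h : v = Polynomial.mkDerivation ℂ (v X) := Polynomial.derivation_ext (by simp)
  conv_lhs => rw [h, Polynomial.mkDerivation_apply, smul_eq_mul]

/-- The Lie subalgebra `𝒜¹` of the `f(x) ∂/∂x` with `f(0) = f'(0) = 0`, that is the linear span of
the `Z_n`, `n ≥ 1`. -/
def A1 : LieSubalgebra ℂ VF where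
  carrier := {v | (X : ℂ[X]) ^ 2 ∣ v X}
  add_mem' {v w} hv hw := dvd_add hv hw
  zero_mem' := dvd_zero _
  smul_mem' c v hv := by
    obtain ⟨q, hq⟩ := hv
    exact ⟨c • q, by rw [Derivation.smul_apply, hq, mul_smul_comm]⟩
  lie_mem' {v w} hv hw := by
    change (X : ℂ[X]) ^ 2 ∣ ⁅v, w⁆ X
    rw [Derivation.commutator_apply]
    rw [v.apply_eq (w X), w.apply_eq (v X)]
    exact dvd_sub (dvd_mul_of_dvd_right hv _) (dvd_mul_of_dvd_right hw _)

/-- The enveloping algebra `U(𝒜)`. -/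
abbrev UA : Type := UniversalEnvelopingAlgebra ℂ VF
/-- The enveloping algebra `U(𝒜¹)`. -/
abbrev UA1 : Type := UniversalEnvelopingAlgebra ℂ A1

/-- The canonical map `U(𝒜¹) → U(𝒜)` induced by the inclusion `𝒜¹ ⊆ 𝒜`. -/
def incl : UA1 →ₐ[ℂ] UA :=
  UniversalEnvelopingAlgebra.lift ℂ ((UniversalEnvelopingAlgebra.ι ℂ).comp A1.incl)

end


/-- The generator `Z_{k-1}` as an element of `U(𝒜)`; in particular `z 0 = Z_{-1}`, `z 1 = Z_0`. -/
def z (k : ℕ) : UA := UniversalEnvelopingAlgebra.ι ℂ (vf k)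

/-- The ordered monomial `Z_n^{a_n} ⋯ Z_1^{a_1} Z_0^{a_0} Z_{-1}^{a_{-1}}` in `U(𝒜)`; the exponent of
`Z_{k-1}` is `a k`, and the factors come in order of decreasing `k`. -/
def pbw (a : ℕ →₀ ℕ) : UA := ((a.support.sort (· ≥ ·)).map fun k => z k ^ a k).prod

/-- The product of the generators listed in `l`, in the order of the list. -/
def word (l : List ℕ) : UA := (l.map z).prod

theorem word_cons (k : ℕ) (l : List ℕ) : word (k :: l) = z k * word l := by simp [word]

theorem word_append (l m : List ℕ) : word (l ++ m) = word l * word m := by simp [word]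

theorem pbw_single_add (n : ℕ) (a : ℕ →₀ ℕ) (h : ∀ k ∈ a.support, k ≤ n) :
    pbw (Finsupp.single n 1 + a) = z n * pbw a := by
  classical
  by_cases hn : n ∈ a.support
  · have hs : (Finsupp.single n 1 + a).support = insert n (a.support.erase n) := by
      ext k
      by_cases hk : k = n
      · subst hk; simp
      · simp [hk]
    have hs' : a.support = insert n (a.support.erase n) := (Finset.insert_erase hn).symm
    have hle : ∀ b ∈ a.support.erase n, n ≥ b := fun b hb => h b (Finset.mem_of_mem_erase hb)
    have hmap : ∀ (b : ℕ →₀ ℕ), b.support = insert n (a.support.erase n) → pbw b = z n ^ b n *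
        (((a.support.erase n).sort (· ≥ ·)).map fun k => z k ^ b k).prod := by
      intro b hb
      rw [pbw, hb, Finset.sort_insert _ hle (Finset.notMem_erase _ _), List.map_cons,
        List.prod_cons]
    rw [hmap _ hs, hmap _ hs', ← mul_assoc]
    congr 1
    · simp [pow_add]
    · congr 1
      refine List.map_congr_left fun k hk => ?_
      rw [Finset.mem_sort] at hk
      have : k ≠ n := Finset.ne_of_mem_erase hk
      simp [this.symm]
  · have hs : (Finsupp.single n 1 + a).support = insert n a.support := by
      ext k
      by_cases hk : k = n
      · subst hk; simp
      · simp [hk]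
    rw [pbw, hs, Finset.sort_insert _ h hn, List.map_cons, List.prod_cons]
    have hn0 : a n = 0 := by simpa using hn
    congr 1
    · simp [hn0]
    · rw [pbw]
      congr 1
      refine List.map_congr_left fun k hk => ?_
      rw [Finset.mem_sort] at hk
      have : k ≠ n := fun e => hn (e ▸ hk)
      simp [this.symm]

theorem pbw_eq_word (l : List ℕ) (hl : l.Pairwise (· ≥ ·)) :
    pbw (Multiset.toFinsupp (l : Multiset ℕ)) = word l := by
  induction l with
  | nil => simp [word, pbw]
  | cons n l ih =>
    obtain ⟨hn, hl⟩ := List.pairwise_cons.mp hl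
    rw [word_cons, ← ih hl, ← pbw_single_add, ← Multiset.cons_coe, ← Multiset.singleton_add,
      map_add, Multiset.toFinsupp_singleton]
    intro k hk
    exact hn k (by simpa using hk)

open Polynomial in
theorem VF.ext_X {v w : VF} (h : v X = w X) : v = w := Polynomial.derivation_ext h

open Polynomial in
theorem vf_lie (i j : ℕ) : ∃ (c : ℂ) (k : ℕ), ⁅vf i, vf j⁆ = c • vf k := by
  have hX : ∀ k, vf k X = C ((k.factorial : ℂ)⁻¹) * X ^ k := fun k => by
    rw [vf, Polynomial.mkDerivation_X]
  have main : ∃ (c : ℂ) (k : ℕ), ⁅vf i, vf j⁆ X = c • X ^ k := by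
    rw [Derivation.commutator_apply, VF.apply_eq (vf i) (vf j X), VF.apply_eq (vf j) (vf i X),
      hX, hX]
    rcases i with _ | i
    · rcases j with _ | j
      · exact ⟨0, 0, by simp⟩
      · refine ⟨((j + 1).factorial : ℂ)⁻¹ * (j + 1), j, ?_⟩
        simp [smul_eq_C_mul, mul_assoc]
    · rcases j with _ | j
      · refine ⟨-(((i + 1).factorial : ℂ)⁻¹ * (i + 1)), i, ?_⟩
        simp [smul_eq_C_mul, mul_assoc]
      · refine ⟨((i + 1).factorial : ℂ)⁻¹ * ((j + 1).factorial : ℂ)⁻¹ * ((j : ℂ) - i),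
          i + j + 1, ?_⟩
        simp only [derivative_C_mul, derivative_X_pow, smul_eq_C_mul, map_mul, map_sub, map_natCast,
          Nat.add_sub_cancel, Nat.cast_add, Nat.cast_one, map_add, map_one]
        ring
  obtain ⟨c, k, h⟩ := main
  refine ⟨c * k.factorial, k, VF.ext_X ?_⟩
  have := Nat.factorial_ne_zero k
  rw [h, Derivation.smul_apply, hX, ← smul_eq_C_mul, smul_smul, mul_assoc,
    mul_inv_cancel₀ (by exact_mod_cast this), mul_one]

theorem z_swap (i j : ℕ) : ∃ (c : ℂ) (k : ℕ), z i * z j - z j * z i = c • z k := by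
  obtain ⟨c, k, h⟩ := vf_lie i j
  refine ⟨c, k, ?_⟩
  rw [z, z, z, ← map_smul, ← h, LieHom.map_lie, Ring.lie_def]

/-- The span of the words of length less than `n`. -/
def low (n : ℕ) : Submodule ℂ UA := Submodule.span ℂ (word '' {l | l.length < n})

theorem low_mul (k n : ℕ) (u : UA) (hu : u ∈ low n) : z k * u ∈ low (n + 1) := by
  refine Submodule.span_induction (p := fun u _ => z k * u ∈ low (n + 1)) ?_ ?_ ?_ ?_ hu
  · rintro _ ⟨l, hl, rfl⟩
    exact Submodule.subset_span ⟨k :: l, Nat.succ_lt_succ hl, word_cons k l⟩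
  · simp
  · intro x y _ _ hx hy; rw [mul_add]; exact add_mem hx hy
  · intro c x _ hx; rw [mul_smul_comm]; exact Submodule.smul_mem _ _ hx

theorem word_perm {l m : List ℕ} (h : l.Perm m) : word l - word m ∈ low l.length := by
  induction h with
  | nil => simp
  | cons x h ih =>
    rw [word_cons, word_cons, ← mul_sub]; exact low_mul _ _ _ ih
  | swap x y l =>
    obtain ⟨c, k, h⟩ := z_swap y x
    simp only [word_cons]
    rw [← mul_assoc, ← mul_assoc, ← sub_mul, h, smul_mul_assoc]
    exact Submodule.smul_mem _ _ (Submodule.subset_span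
      ⟨k :: l, by simp, word_cons k l⟩)
  | trans h1 h2 ih1 ih2 =>
    rw [← h1.length_eq] at ih2
    simpa using add_mem ih1 ih2

theorem word_mem (n : ℕ) : ∀ l : List ℕ, l.length < n → word l ∈ Submodule.span ℂ (Set.range pbw) := by
  induction n with
  | zero => intro l hl; exact absurd hl (Nat.not_lt_zero _)
  | succ n ih =>
    intro l hl
    have h1 : word l - word (l.mergeSort (· ≥ ·)) ∈ Submodule.span ℂ (Set.range pbw) := by
      have h2 := word_perm (List.mergeSort_perm l (· ≥ ·)).symm
      refine Submodule.span_le.mpr ?_ h2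
      rintro _ ⟨m, hm, rfl⟩
      exact ih m (lt_of_lt_of_le hm (Nat.lt_succ_iff.mp hl))
    have h3 : word (l.mergeSort (· ≥ ·)) ∈ Submodule.span ℂ (Set.range pbw) := by
      refine Submodule.subset_span ⟨_, pbw_eq_word (l.mergeSort (· ≥ ·)) ?_⟩
      have := List.pairwise_mergeSort (le := fun a b : ℕ => decide (a ≥ b))
        (by intro a b c; simp; omega) (by intro a b; simp; omega) l
      simpa using this
    simpa using add_mem h1 h3

open Polynomial in
theorem vf_span (v : VF) : v ∈ Submodule.span ℂ (Set.range vf) := by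
  have h : ∀ p : ℂ[X], Polynomial.mkDerivation ℂ p ∈ Submodule.span ℂ (Set.range vf) := by
    intro p
    induction p using Polynomial.induction_on' with
    | add p q hp hq => rw [map_add]; exact add_mem hp hq
    | monomial n c =>
      have e : Polynomial.mkDerivation ℂ (monomial n c : ℂ[X]) = (c * n.factorial) • vf n := by
        have := Nat.factorial_ne_zero n
        rw [vf, ← map_smul, ← smul_eq_C_mul, smul_smul, mul_assoc,
          mul_inv_cancel₀ (by exact_mod_cast this), mul_one, smul_eq_C_mul, C_mul_X_pow_eq_monomial]
      rw [e]
      exact Submodule.smul_mem _ _ (Submodule.subset_span ⟨n, rfl⟩)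
  have e : v = Polynomial.mkDerivation ℂ (v X) := VF.ext_X (by simp)
  rw [e]; exact h _

/-- The ordered monomials span. -/
theorem pbw_span : Submodule.span ℂ (Set.range pbw) = ⊤ := by
  let S : Subalgebra ℂ UA := Algebra.adjoin ℂ (Set.range z)
  have hι : ∀ v : VF, UniversalEnvelopingAlgebra.ι ℂ v ∈ S := by
    intro v
    refine Submodule.span_induction
      (p := fun v _ => UniversalEnvelopingAlgebra.ι ℂ v ∈ S) ?_ ?_ ?_ ?_ (vf_span v)
    · rintro _ ⟨k, rfl⟩; exact Algebra.subset_adjoin ⟨k, rfl⟩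
    · rw [map_zero]; exact zero_mem S
    · intro x y _ _ hx hy; rw [map_add]; exact add_mem hx hy
    · intro c x _ hx; rw [map_smul]; exact S.smul_mem hx c
  let f : VF →ₗ⁅ℂ⁆ S :=
    { toFun := fun v => ⟨UniversalEnvelopingAlgebra.ι ℂ v, hι v⟩
      map_add' := fun v w => Subtype.ext (map_add (UniversalEnvelopingAlgebra.ι ℂ) v w)
      map_smul' := fun c v => Subtype.ext (map_smul (UniversalEnvelopingAlgebra.ι ℂ) c v)
      map_lie' := fun {v w} => Subtype.ext (LieHom.map_lie _ v w) }
  have hid : S.val.comp (UniversalEnvelopingAlgebra.lift ℂ f) = AlgHom.id ℂ UA := by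
    apply UniversalEnvelopingAlgebra.hom_ext
    ext v
    change S.val (UniversalEnvelopingAlgebra.lift ℂ f (UniversalEnvelopingAlgebra.ι ℂ v)) =
      UniversalEnvelopingAlgebra.ι ℂ v
    rw [UniversalEnvelopingAlgebra.lift_ι_apply]
    rfl
  rw [eq_top_iff]
  intro u _
  have hu : u ∈ S := by
    have := AlgHom.congr_fun hid u
    rw [AlgHom.id_apply] at this
    rw [← this]
    exact (UniversalEnvelopingAlgebra.lift ℂ f u).2
  have hu' : u ∈ Submodule.span ℂ ((Submonoid.closure (Set.range z) : Submonoid UA) : Set UA) := by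
    rw [← Algebra.adjoin_eq_span]; exact hu
  refine Submodule.span_le.mpr ?_ hu'
  intro x hx
  have : ∃ l, x = word l := by
    induction hx using Submonoid.closure_induction with
    | mem x hx => obtain ⟨k, rfl⟩ := hx; exact ⟨[k], by simp [word]⟩
    | one => exact ⟨[], by simp [word]⟩
    | mul x y _ _ hx hy =>
      obtain ⟨l, rfl⟩ := hx
      obtain ⟨m, rfl⟩ := hy
      exact ⟨l ++ m, (word_append l m).symm⟩
  obtain ⟨l, rfl⟩ := this
  exact word_mem _ l (Nat.lt_succ_self _)

/-- The action of `f ∂/∂x` on pairs `(p, c)`, where `(p, c)` stands for the function `p(x) + c s` and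
`f ∂/∂x` acts as `f ∂/∂x - f' ∂/∂s`. It serves to show that the form `L0` exists. -/
def act : VF →ₗ⁅ℂ⁆ Module.End ℂ (Polynomial ℂ × ℂ) where
  toFun v :=
    { toFun := fun m => (v m.1 - m.2 • Polynomial.derivative (v Polynomial.X), 0)
      map_add' := fun m n => by ext1 <;> simp [add_smul]; ring
      map_smul' := fun c m => by ext1 <;> simp [smul_smul, smul_sub] }
  map_add' v w := by
    refine LinearMap.ext fun m => ?_
    ext1 <;> simp [smul_add]; ring
  map_smul' c v := by
    refine LinearMap.ext fun m => ?_
    ext1 <;> simp [smul_smul, smul_sub, mul_comm]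
  map_lie' {v w} := by
    refine LinearMap.ext fun m => ?_
    rw [Ring.lie_def]
    ext1
    · simp only [LinearMap.coe_mk, AddHom.coe_mk, LinearMap.sub_apply, Module.End.mul_apply,
        Derivation.commutator_apply, zero_smul, sub_zero, Prod.fst_sub, map_sub,
        Derivation.map_smul]
      rw [VF.apply_eq v (w Polynomial.X), VF.apply_eq w (v Polynomial.X),
        VF.apply_eq v (Polynomial.derivative (w Polynomial.X)),
        VF.apply_eq w (Polynomial.derivative (v Polynomial.X))]
      simp only [Polynomial.derivative_mul, Polynomial.smul_eq_C_mul]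
      ring
    · simp

/-- The extension of `act` to `U(𝒜)`. -/
def actHom : UA →ₐ[ℂ] Module.End ℂ (Polynomial ℂ × ℂ) := UniversalEnvelopingAlgebra.lift ℂ act

theorem actHom_z (k : ℕ) (p : Polynomial ℂ) (c : ℂ) : actHom (z k) (p, c) =
    (Polynomial.C ((k.factorial : ℂ)⁻¹) * (Polynomial.derivative p * Polynomial.X ^ k -
      c • Polynomial.derivative (Polynomial.X ^ k)), 0) := by
  rw [actHom, z, UniversalEnvelopingAlgebra.lift_ι_apply]
  change (vf k p - c • Polynomial.derivative (vf k Polynomial.X), (0 : ℂ)) = _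
  rw [VF.apply_eq (vf k) p, vf, Polynomial.mkDerivation_X, Polynomial.derivative_C_mul]
  simp only [Polynomial.smul_eq_C_mul]
  ext1
  · ring
  · rfl

/-- The form `a ↦ -(a · s)(0)`. -/
def ev : UA →ₗ[ℂ] ℂ where
  toFun u := -((actHom u (0, 1)).1.eval 0)
  map_add' u v := by simp; ring
  map_smul' c u := by simp

theorem act_word (l : List ℕ) (k : ℕ) (hl : (k :: l).Pairwise (· ≥ ·)) :
    ∃ p : Polynomial ℂ, actHom (word (k :: l)) (0, 1) = (p, 0) ∧
      p.eval 0 = (if k :: l = [1] then -1 else 0) ∧ (k = 0 → p = 0) ∧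
      (k = 1 → Polynomial.derivative p = 0) := by
  induction l generalizing k with
  | nil =>
    refine ⟨_, by rw [word_cons, word, List.map_nil, List.prod_nil, mul_one, actHom_z], ?_, ?_, ?_⟩
    · rcases k with _ | _ | k <;> simp
    · rintro rfl; simp
    · rintro rfl; simp
  | cons j l ih =>
    obtain ⟨hk, hl'⟩ := List.pairwise_cons.mp hl
    obtain ⟨p, h1, -, h3, h4⟩ := ih j hl'
    have hj : j ≤ k := hk j (List.mem_cons_self ..)
    refine ⟨_, by rw [word_cons, map_mul, Module.End.mul_apply, h1, actHom_z], ?_, ?_, ?_⟩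
    · rcases k with _ | k
      · simp [h3 (by omega)]
      · simp
    · rintro rfl
      simp [h3 (by omega)]
    · rintro rfl
      have : Polynomial.derivative p = 0 := by
        rcases j with _ | _ | j
        · simp [h3 rfl]
        · exact h4 rfl
        · omega
      simp [this]

theorem ev_word (l : List ℕ) (hl : l.Pairwise (· ≥ ·)) :
    ev (word l) = if l = [1] then 1 else 0 := by
  rcases l with _ | ⟨k, l⟩
  · simp [word, ev]
  · obtain ⟨p, h1, h2, -⟩ := act_word l k hl
    change -((actHom (word (k :: l)) (0, 1)).1.eval 0) = _
    rw [h1, h2]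
    split_ifs <;> simp

theorem ev_pbw (a : ℕ →₀ ℕ) :
    ev (pbw a) = if a = Finsupp.single 1 1 then 1 else 0 := by
  have hs := (Finsupp.toMultiset a).pairwise_sort (· ≥ ·)
  have h1 : Multiset.toFinsupp (((Finsupp.toMultiset a).sort (· ≥ ·) : List ℕ) : Multiset ℕ) = a := by
    rw [Multiset.sort_eq, Finsupp.toMultiset_toFinsupp]
  have h2 := pbw_eq_word _ hs
  rw [h1] at h2
  rw [h2, ev_word _ hs]
  refine if_congr ⟨fun h => ?_, fun h => ?_⟩ rfl rfl
  · rw [h] at h1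
    rw [← h1, Multiset.coe_singleton, Multiset.toFinsupp_singleton]
  · rw [h, Finsupp.toMultiset_single, one_smul, Multiset.sort_singleton]

/-- There is exactly one linear form on `U(𝒜)` that is `1` on `Z_0` and `0` on all other ordered
monomials (the index `1` is that of `Z_0`). -/
theorem existsUnique_L0 : ∃! L : UA →ₗ[ℂ] ℂ,
    ∀ a : ℕ →₀ ℕ, L (pbw a) = if a = Finsupp.single 1 1 then 1 else 0 := by
  refine ⟨ev, ev_pbw, fun L hL => ?_⟩
  refine LinearMap.ext_on_range pbw_span fun a => ?_
  rw [hL, ev_pbw]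

/-- The linear form `L_0` on `U(𝒜)`: the coefficient of `Z_0` with respect to the ordered monomials. -/
def L0 : UA →ₗ[ℂ] ℂ := existsUnique_L0.choose

theorem L0_pbw (a : ℕ →₀ ℕ) : L0 (pbw a) = if a = Finsupp.single 1 1 then 1 else 0 :=
  existsUnique_L0.choose_spec.1 a


/-- The polynomial algebra in the commuting variables `δ_1, δ_2, …`; the variable `X i` is `δ_{i+1}`. -/
abbrev PolyDelta : Type := MvPolynomial ℕ ℂ

/-- The derivation `[X, ·]`, given by `[X, δ_n] = δ_{n+1}`. -/
def adX : Derivation ℂ PolyDelta PolyDelta :=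
  MvPolynomial.mkDerivation ℂ fun i => MvPolynomial.X (i + 1)

/-- The derivation `[Y, ·]`, given by `[Y, δ_n] = n δ_n`. -/
def adY : Derivation ℂ PolyDelta PolyDelta :=
  MvPolynomial.mkDerivation ℂ fun i => ((i : ℂ) + 1) • MvPolynomial.X i

/-- Multiplication by `δ_1`. -/
def mulDelta1 : PolyDelta →ₗ[ℂ] PolyDelta := LinearMap.mulLeft ℂ (MvPolynomial.X 0)

/-- The operator `[Δ X, ·] = [X ⊗ 1 + 1 ⊗ X + δ_1 ⊗ Y, ·]` on the tensor square of the commutative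
algebra generated by the `δ_n`; note `[δ_1 ⊗ Y, P ⊗ Q] = δ_1 P ⊗ [Y, Q]`. -/
def adDeltaX : PolyDelta ⊗[ℂ] PolyDelta →ₗ[ℂ] PolyDelta ⊗[ℂ] PolyDelta :=
  TensorProduct.map (adX : PolyDelta →ₗ[ℂ] PolyDelta) LinearMap.id
    + TensorProduct.map LinearMap.id (adX : PolyDelta →ₗ[ℂ] PolyDelta)
    + TensorProduct.map mulDelta1 (adY : PolyDelta →ₗ[ℂ] PolyDelta)

/-- The operator `[Δ Y, ·] = [Y ⊗ 1 + 1 ⊗ Y, ·]`. -/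
def adDeltaY : PolyDelta ⊗[ℂ] PolyDelta →ₗ[ℂ] PolyDelta ⊗[ℂ] PolyDelta :=
  TensorProduct.map (adY : PolyDelta →ₗ[ℂ] PolyDelta) LinearMap.id
    + TensorProduct.map LinearMap.id (adY : PolyDelta →ₗ[ℂ] PolyDelta)

/-- `comulDelta i = Δ δ_{i+1}`, by `Δ δ_1 = δ_1 ⊗ 1 + 1 ⊗ δ_1` and
`Δ δ_{n+1} = Δ [X, δ_n] = [Δ X, Δ δ_n]`. -/
def comulDelta : ℕ → PolyDelta ⊗[ℂ] PolyDelta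
  | 0 => MvPolynomial.X 0 ⊗ₜ[ℂ] 1 + 1 ⊗ₜ[ℂ] MvPolynomial.X 0
  | n + 1 => adDeltaX (comulDelta n)

/-- The coproduct `Δ`, an algebra homomorphism. -/
def comulHom : PolyDelta →ₐ[ℂ] PolyDelta ⊗[ℂ] PolyDelta := MvPolynomial.aeval comulDelta

/-- The counit `P ↦ P(0)`. -/
def counitHom : PolyDelta →ₐ[ℂ] ℂ := MvPolynomial.aeval fun _ => 0

@[simp] theorem comulHom_X (n : ℕ) : comulHom (MvPolynomial.X n) = comulDelta n := by
  simp [comulHom]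
@[simp] theorem counitHom_X (n : ℕ) : counitHom (MvPolynomial.X n) = 0 := by
  simp [counitHom]
@[simp] theorem adX_X (n : ℕ) : adX (MvPolynomial.X n) = MvPolynomial.X (n + 1) := by
  simp [adX, MvPolynomial.mkDerivation_X]
@[simp] theorem adY_X (n : ℕ) :
    adY (MvPolynomial.X n) = ((n : ℂ) + 1) • MvPolynomial.X n := by
  simp [adY, MvPolynomial.mkDerivation_X]
@[simp] theorem adX_one : adX (1 : PolyDelta) = 0 := adX.map_one_eq_zero
@[simp] theorem adY_one : adY (1 : PolyDelta) = 0 := adY.map_one_eq_zero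
@[simp] theorem mulDelta1_apply (p : PolyDelta) : mulDelta1 p = MvPolynomial.X 0 * p := rfl

@[simp] theorem adDeltaX_tmul (p q : PolyDelta) : adDeltaX (p ⊗ₜ[ℂ] q) =
    adX p ⊗ₜ[ℂ] q + p ⊗ₜ[ℂ] adX q + (MvPolynomial.X 0 * p) ⊗ₜ[ℂ] adY q := by
  simp [adDeltaX]
@[simp] theorem adDeltaY_tmul (p q : PolyDelta) : adDeltaY (p ⊗ₜ[ℂ] q) =
    adY p ⊗ₜ[ℂ] q + p ⊗ₜ[ℂ] adY q := by
  simp [adDeltaY]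

/-- Two linear maps that are derivations along an algebra map agree if they agree on generators. -/
theorem derivAlong_ext {B : Type*} [CommRing B] [Algebra ℂ B] (φ : PolyDelta →ₐ[ℂ] B)
    (F G : PolyDelta →ₗ[ℂ] B)
    (hF : ∀ p q, F (p * q) = F p * φ q + φ p * F q)
    (hG : ∀ p q, G (p * q) = G p * φ q + φ p * G q)
    (h : ∀ n, F (MvPolynomial.X n) = G (MvPolynomial.X n)) : F = G := by
  have h1 : ∀ T : PolyDelta →ₗ[ℂ] B, (∀ p q, T (p * q) = T p * φ q + φ p * T q) → T 1 = 0 := by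
    intro T hT
    have := hT 1 1
    simpa using this
  refine LinearMap.ext fun p => ?_
  induction p using MvPolynomial.induction_on with
  | C a =>
    rw [← mul_one (MvPolynomial.C a), ← MvPolynomial.smul_eq_C_mul, map_smul, map_smul, h1 F hF,
      h1 G hG]
  | add p q hp hq => rw [map_add, map_add, hp, hq]
  | mul_X p n hp => rw [hF, hG, hp, h]

theorem adDeltaX_mul (s t : PolyDelta ⊗[ℂ] PolyDelta) :
    adDeltaX (s * t) = adDeltaX s * t + s * adDeltaX t := by
  induction s using TensorProduct.induction_on with
  | zero => simp
  | add x y hx hy => simp only [add_mul, map_add, hx, hy]; ring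
  | tmul a b =>
    induction t using TensorProduct.induction_on with
    | zero => simp
    | add x y hx hy => simp only [mul_add, map_add, hx, hy]; ring
    | tmul c d =>
      simp only [Algebra.TensorProduct.tmul_mul_tmul, adDeltaX_tmul, Derivation.leibniz,
        smul_eq_mul, add_mul, mul_add, TensorProduct.add_tmul, TensorProduct.tmul_add]
      rw [mul_comm c (adX a), mul_comm d (adX b), mul_comm d (adY b), mul_assoc,
        mul_left_comm a (MvPolynomial.X 0)]
      abel

theorem adDeltaY_mul (s t : PolyDelta ⊗[ℂ] PolyDelta) :
    adDeltaY (s * t) = adDeltaY s * t + s * adDeltaY t := by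
  induction s using TensorProduct.induction_on with
  | zero => simp
  | add x y hx hy => simp only [add_mul, map_add, hx, hy]; ring
  | tmul a b =>
    induction t using TensorProduct.induction_on with
    | zero => simp
    | add x y hx hy => simp only [mul_add, map_add, hx, hy]; ring
    | tmul c d =>
      simp only [Algebra.TensorProduct.tmul_mul_tmul, adDeltaY_tmul, Derivation.leibniz,
        smul_eq_mul, add_mul, mul_add, TensorProduct.add_tmul, TensorProduct.tmul_add]
      rw [mul_comm c (adY a), mul_comm d (adY b)]
      abel

theorem comulHom_adX (p : PolyDelta) : comulHom (adX p) = adDeltaX (comulHom p) := by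
  refine LinearMap.congr_fun (derivAlong_ext comulHom
    (comulHom.toLinearMap ∘ₗ (adX : PolyDelta →ₗ[ℂ] PolyDelta))
    (adDeltaX ∘ₗ comulHom.toLinearMap) (fun p q => ?_) (fun p q => ?_) (fun n => ?_)) p
  · simp; ring
  · simp [adDeltaX_mul]
  · simp [comulDelta]

theorem adY_adX (p : PolyDelta) : adY (adX p) = adX (adY p) + adX p := by
  have h : ⁅adY, adX⁆ = adX := by
    apply MvPolynomial.derivation_ext
    intro n
    simp only [Derivation.commutator_apply, adX_X, adY_X, Derivation.map_smul]
    push_cast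
    module
  have := congrArg (fun d : Derivation ℂ PolyDelta PolyDelta => d p) h
  simp only [Derivation.commutator_apply] at this
  exact sub_eq_iff_eq_add'.mp this

theorem adDeltaY_adDeltaX (t : PolyDelta ⊗[ℂ] PolyDelta) :
    adDeltaY (adDeltaX t) = adDeltaX (adDeltaY t) + adDeltaX t := by
  induction t using TensorProduct.induction_on with
  | zero => simp
  | add x y hx hy => simp only [map_add, hx, hy]; abel
  | tmul p q =>
    simp only [adDeltaX_tmul, adDeltaY_tmul, map_add, adY_adX, TensorProduct.add_tmul,
      TensorProduct.tmul_add, Derivation.leibniz, smul_eq_mul, adY_X, Nat.cast_zero, zero_add,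
      one_smul, mul_comm p]
    abel

theorem adDeltaY_comulDelta (n : ℕ) :
    adDeltaY (comulDelta n) = ((n : ℂ) + 1) • comulDelta n := by
  induction n with
  | zero => simp [comulDelta]
  | succ n ih =>
    rw [comulDelta, adDeltaY_adDeltaX, ih, map_smul]
    push_cast
    module

theorem comulHom_adY (p : PolyDelta) : comulHom (adY p) = adDeltaY (comulHom p) := by
  refine LinearMap.congr_fun (derivAlong_ext comulHom
    (comulHom.toLinearMap ∘ₗ (adY : PolyDelta →ₗ[ℂ] PolyDelta))
    (adDeltaY ∘ₗ comulHom.toLinearMap) (fun p q => ?_) (fun p q => ?_) (fun n => ?_)) p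
  · simp; ring
  · simp [adDeltaY_mul]
  · simp [adDeltaY_comulDelta]

theorem counitHom_adX (p : PolyDelta) : counitHom (adX p) = 0 := by
  refine LinearMap.congr_fun (derivAlong_ext counitHom
    (counitHom.toLinearMap ∘ₗ (adX : PolyDelta →ₗ[ℂ] PolyDelta)) 0
    (fun p q => ?_) (fun p q => ?_) (fun n => ?_)) p
  · simp; ring
  · simp
  · simp

theorem counitHom_adY (p : PolyDelta) : counitHom (adY p) = 0 := by
  refine LinearMap.congr_fun (derivAlong_ext counitHom
    (counitHom.toLinearMap ∘ₗ (adY : PolyDelta →ₗ[ℂ] PolyDelta)) 0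
    (fun p q => ?_) (fun p q => ?_) (fun n => ?_)) p
  · simp; ring
  · simp
  · simp

theorem counit_comul_left :
    (Algebra.TensorProduct.map counitHom (.id ℂ PolyDelta)).comp comulHom
      = ((Algebra.TensorProduct.lid ℂ PolyDelta).symm : PolyDelta →ₐ[ℂ] ℂ ⊗[ℂ] PolyDelta) := by
  have key : ∀ t, Algebra.TensorProduct.map counitHom (.id ℂ PolyDelta) (adDeltaX t) =
      TensorProduct.map LinearMap.id (adX : PolyDelta →ₗ[ℂ] PolyDelta)
        (Algebra.TensorProduct.map counitHom (.id ℂ PolyDelta) t) := by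
    intro t
    induction t using TensorProduct.induction_on with
    | zero => simp
    | add x y hx hy => simp only [map_add, hx, hy]
    | tmul p q => simp [counitHom_adX]
  apply MvPolynomial.algHom_ext
  intro n
  simp only [AlgHom.comp_apply, comulHom_X]
  induction n with
  | zero => simp [comulDelta]
  | succ n ih => rw [comulDelta, key, ih]; simp

theorem counit_comul_right :
    (Algebra.TensorProduct.map (.id ℂ PolyDelta) counitHom).comp comulHom
      = ((Algebra.TensorProduct.rid ℂ ℂ PolyDelta).symm : PolyDelta →ₐ[ℂ] PolyDelta ⊗[ℂ] ℂ) := by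
  have key : ∀ t, Algebra.TensorProduct.map (.id ℂ PolyDelta) counitHom (adDeltaX t) =
      TensorProduct.map (adX : PolyDelta →ₗ[ℂ] PolyDelta) LinearMap.id
        (Algebra.TensorProduct.map (.id ℂ PolyDelta) counitHom t) := by
    intro t
    induction t using TensorProduct.induction_on with
    | zero => simp
    | add x y hx hy => simp only [map_add, hx, hy]
    | tmul p q => simp [counitHom_adX, counitHom_adY]
  apply MvPolynomial.algHom_ext
  intro n
  simp only [AlgHom.comp_apply, comulHom_X]
  induction n with
  | zero => simp [comulDelta]
  | succ n ih => rw [comulDelta, key, ih]; simp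

theorem comul_coassoc :
    ((Algebra.TensorProduct.assoc ℂ ℂ ℂ PolyDelta PolyDelta PolyDelta).toAlgHom.comp
      ((Algebra.TensorProduct.map comulHom (.id ℂ PolyDelta)).comp comulHom))
      = (Algebra.TensorProduct.map (.id ℂ PolyDelta) comulHom).comp comulHom := by
  let T : PolyDelta ⊗[ℂ] (PolyDelta ⊗[ℂ] PolyDelta) →ₗ[ℂ] PolyDelta ⊗[ℂ] (PolyDelta ⊗[ℂ] PolyDelta) :=
    TensorProduct.map (adX : PolyDelta →ₗ[ℂ] PolyDelta) LinearMap.id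
    + TensorProduct.map LinearMap.id adDeltaX + TensorProduct.map mulDelta1 adDeltaY
  have hT : ∀ p s, T (p ⊗ₜ[ℂ] s) = adX p ⊗ₜ[ℂ] s + p ⊗ₜ[ℂ] adDeltaX s
      + (MvPolynomial.X 0 * p) ⊗ₜ[ℂ] adDeltaY s := fun p s => by simp [T]
  have hR : ∀ t, Algebra.TensorProduct.map (.id ℂ PolyDelta) comulHom (adDeltaX t) =
      T (Algebra.TensorProduct.map (.id ℂ PolyDelta) comulHom t) := by
    intro t
    induction t using TensorProduct.induction_on with
    | zero => simp
    | add x y hx hy => simp only [map_add, hx, hy]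
    | tmul p q => simp [hT, comulHom_adX, comulHom_adY]
  have hA : ∀ s q, Algebra.TensorProduct.assoc ℂ ℂ ℂ PolyDelta PolyDelta PolyDelta
      (adDeltaX s ⊗ₜ[ℂ] q + s ⊗ₜ[ℂ] adX q + (comulDelta 0 * s) ⊗ₜ[ℂ] adY q) =
      T (Algebra.TensorProduct.assoc ℂ ℂ ℂ PolyDelta PolyDelta PolyDelta (s ⊗ₜ[ℂ] q)) := by
    intro s q
    induction s using TensorProduct.induction_on with
    | zero => simp
    | add x y hx hy =>
      simp only [map_add, TensorProduct.add_tmul, mul_add] at hx hy ⊢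
      rw [← hx, ← hy]; abel
    | tmul a b =>
      simp only [adDeltaX_tmul, adDeltaY_tmul, comulDelta, add_mul, TensorProduct.add_tmul,
        Algebra.TensorProduct.tmul_mul_tmul, map_add, Algebra.TensorProduct.assoc_tmul, hT,
        TensorProduct.tmul_add, one_mul]
      abel
  have hL : ∀ t, Algebra.TensorProduct.assoc ℂ ℂ ℂ PolyDelta PolyDelta PolyDelta
        (Algebra.TensorProduct.map comulHom (.id ℂ PolyDelta) (adDeltaX t)) =
      T (Algebra.TensorProduct.assoc ℂ ℂ ℂ PolyDelta PolyDelta PolyDelta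
        (Algebra.TensorProduct.map comulHom (.id ℂ PolyDelta) t)) := by
    intro t
    induction t using TensorProduct.induction_on with
    | zero => simp
    | add x y hx hy => simp only [map_add, hx, hy]
    | tmul p q =>
      rw [Algebra.TensorProduct.map_tmul, AlgHom.id_apply, ← hA]
      simp [comulHom_adX]
  apply MvPolynomial.algHom_ext
  intro n
  simp only [AlgHom.comp_apply, comulHom_X]
  induction n with
  | zero =>
    simp [comulDelta, TensorProduct.add_tmul, TensorProduct.tmul_add,
      Algebra.TensorProduct.one_def, add_assoc]
  | succ n ih => 
    rw [comulDelta, hR, ← ih]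
    exact hL _

/-- The bialgebra `ℋ¹` of polynomials in the `δ_n`, with the coproduct `Δ` and the counit `P ↦ P(0)`.
It is a type of its own because a polynomial algebra carries another coproduct in Mathlib. -/
def H1 : Type := MvPolynomial ℕ ℂ

instance : CommRing H1 := inferInstanceAs (CommRing (MvPolynomial ℕ ℂ))

instance : Bialgebra ℂ H1 :=
  @Bialgebra.ofAlgHom ℂ PolyDelta _ _ _ comulHom counitHom comul_coassoc counit_comul_left counit_comul_right

/-- For `f = ∑ c_n x^(n+1)/(n+1)!`, summed over `n ≥ 1`, the linear form
`P ↦ ∑ c_n (∂P/∂δ_n)(0)`; here `c_n` is the derivative of order `n + 1` of `f` at `0`. Thus `Z_n`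
gives the form `P ↦ (∂P/∂δ_n)(0)`, see `tangent_vf`. -/
def tangent (f : Polynomial ℂ) : PolyDelta →ₗ[ℂ] ℂ :=
  counitHom.toLinearMap ∘ₗ
    ((MvPolynomial.mkDerivation ℂ fun i =>
        MvPolynomial.C ((Polynomial.derivative^[i + 2] f).eval 0) :
      Derivation ℂ PolyDelta PolyDelta) : PolyDelta →ₗ[ℂ] PolyDelta)

theorem tangent_mul (f : Polynomial ℂ) (p q : PolyDelta) :
    tangent f (p * q) = tangent f p * counitHom q + counitHom p * tangent f q := by
  simp [tangent]; ring

@[simp] theorem counitHom_C (c : ℂ) : counitHom (MvPolynomial.C c) = c := by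
  simp [counitHom]

@[simp] theorem tangent_X (f : Polynomial ℂ) (n : ℕ) :
    tangent f (MvPolynomial.X n) = (Polynomial.derivative^[n + 2] f).eval 0 := by
  simp [tangent, MvPolynomial.mkDerivation_X]

@[simp] theorem tangent_one (f : Polynomial ℂ) : tangent f 1 = 0 := by
  simp [tangent]

theorem tangent_eq (f : Polynomial ℂ) (T : PolyDelta →ₗ[ℂ] ℂ)
    (hT : ∀ p q, T (p * q) = T p * counitHom q + counitHom p * T q)
    (h : ∀ n, T (MvPolynomial.X n) = (Polynomial.derivative^[n + 2] f).eval 0) : T = tangent f :=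
  derivAlong_ext counitHom T (tangent f) hT (tangent_mul f) fun n => by rw [h, tangent_X]

theorem iter_add (f g : Polynomial ℂ) (n : ℕ) : Polynomial.derivative^[n] (f + g) =
    Polynomial.derivative^[n] f + Polynomial.derivative^[n] g := by
  induction n generalizing f g with
  | zero => rfl
  | succ n ih => simp only [Function.iterate_succ_apply, map_add, ih]

theorem eval_iter (f : Polynomial ℂ) (n : ℕ) :
    (Polynomial.derivative^[n] f).eval 0 = n.factorial * f.coeff n := by
  rw [← Polynomial.coeff_zero_eq_eval_zero, Polynomial.coeff_iterate_derivative, zero_add,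
    Nat.descFactorial_self, nsmul_eq_mul]

/-- `f' - f''(0) x`. -/
def shift (f : Polynomial ℂ) : Polynomial ℂ :=
  Polynomial.derivative f - Polynomial.C (2 * f.coeff 2) * Polynomial.X

theorem tangent_adX (f : Polynomial ℂ) (p : PolyDelta) : tangent f (adX p) = tangent (shift f) p := by
  refine LinearMap.congr_fun (tangent_eq (shift f)
    (tangent f ∘ₗ (adX : PolyDelta →ₗ[ℂ] PolyDelta)) (fun p q => ?_) (fun n => ?_)) p
  · simp [tangent_mul, counitHom_adX]; ring
  · simp only [LinearMap.comp_apply, Derivation.coeFn_coe, adX_X, tangent_X, shift,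
      Function.iterate_succ_apply]
    simp

/-- The form `S ⊗ T`. -/
def conv (S T : PolyDelta →ₗ[ℂ] ℂ) : PolyDelta ⊗[ℂ] PolyDelta →ₗ[ℂ] ℂ :=
  LinearMap.mul' ℂ ℂ ∘ₗ TensorProduct.map S T

@[simp] theorem conv_tmul (S T : PolyDelta →ₗ[ℂ] ℂ) (p q : PolyDelta) :
    conv S T (p ⊗ₜ[ℂ] q) = S p * T q := by simp [conv]

theorem conv_counit_left (T : PolyDelta →ₗ[ℂ] ℂ) (p : PolyDelta) :
    conv counitHom.toLinearMap T (comulHom p) = T p := by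
  have h1 : ∀ t, conv counitHom.toLinearMap T t =
      T (Algebra.TensorProduct.lid ℂ PolyDelta
        (Algebra.TensorProduct.map counitHom (.id ℂ PolyDelta) t)) := by
    intro t
    induction t using TensorProduct.induction_on with
    | zero => simp
    | add x y hx hy => simp only [map_add, hx, hy]
    | tmul p q => simp
  have h2 := AlgHom.congr_fun counit_comul_left p
  rw [AlgHom.comp_apply] at h2
  rw [h1, h2]; simp

theorem conv_counit_right (T : PolyDelta →ₗ[ℂ] ℂ) (p : PolyDelta) :
    conv T counitHom.toLinearMap (comulHom p) = T p := by
  have h1 : ∀ t, conv T counitHom.toLinearMap t =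
      T (Algebra.TensorProduct.rid ℂ ℂ PolyDelta
        (Algebra.TensorProduct.map (.id ℂ PolyDelta) counitHom t)) := by
    intro t
    induction t using TensorProduct.induction_on with
    | zero => simp
    | add x y hx hy => simp only [map_add, hx, hy]
    | tmul p q => simp [mul_comm]
  have h2 := AlgHom.congr_fun counit_comul_right p
  rw [AlgHom.comp_apply] at h2
  rw [h1, h2]; simp

theorem conv_counit_counit (p : PolyDelta) :
    conv counitHom.toLinearMap counitHom.toLinearMap (comulHom p) = counitHom p :=
  conv_counit_left _ p

theorem conv_mul (f g : Polynomial ℂ) (s t : PolyDelta ⊗[ℂ] PolyDelta) :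
    conv (tangent f) (tangent g) (s * t) =
      conv (tangent f) (tangent g) s * conv counitHom.toLinearMap counitHom.toLinearMap t
      + conv (tangent f) counitHom.toLinearMap s * conv counitHom.toLinearMap (tangent g) t
      + conv counitHom.toLinearMap (tangent g) s * conv (tangent f) counitHom.toLinearMap t
      + conv counitHom.toLinearMap counitHom.toLinearMap s * conv (tangent f) (tangent g) t := by
  induction s using TensorProduct.induction_on with
  | zero => simp
  | add x y hx hy => simp only [add_mul, map_add, hx, hy]; ring
  | tmul a b =>
    induction t using TensorProduct.induction_on with
    | zero => simp
    | add x y hx hy => simp only [mul_add, map_add, hx, hy]; ring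
    | tmul c d => simp [tangent_mul]; ring

theorem conv_adDeltaX (f g : Polynomial ℂ) (n : ℕ) :
    conv (tangent f) (tangent g) (comulDelta (n + 1)) =
      conv (tangent (shift f)) (tangent g) (comulDelta n)
      + conv (tangent f) (tangent (shift g)) (comulDelta n)
      + (n + 1) * tangent f (MvPolynomial.X 0) * tangent g (MvPolynomial.X n) := by
  have key : ∀ t, conv (tangent f) (tangent g) (adDeltaX t) =
      conv (tangent (shift f)) (tangent g) t + conv (tangent f) (tangent (shift g)) t
      + tangent f (MvPolynomial.X 0) * conv counitHom.toLinearMap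
        (tangent g ∘ₗ (adY : PolyDelta →ₗ[ℂ] PolyDelta)) t := by
    intro t
    induction t using TensorProduct.induction_on with
    | zero => simp
    | add x y hx hy => simp only [map_add, hx, hy]; ring
    | tmul p q => simp [tangent_mul, tangent_adX]; ring
  rw [comulDelta, key, ← comulHom_X n, conv_counit_left]
  simp; ring

theorem conv_comulDelta (n : ℕ) : ∀ f g : Polynomial ℂ,
    f.coeff 0 = 0 → f.coeff 1 = 0 → g.coeff 0 = 0 → g.coeff 1 = 0 →
    conv (tangent f) (tangent g) (comulDelta n) - conv (tangent g) (tangent f) (comulDelta n) =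
      (Polynomial.derivative^[n + 2]
        (f * Polynomial.derivative g - g * Polynomial.derivative f)).eval 0 := by
  have hs : ∀ f : Polynomial ℂ, f.coeff 1 = 0 → (shift f).coeff 0 = 0 ∧ (shift f).coeff 1 = 0 := by
    intro f h
    simp [shift, Polynomial.coeff_derivative, h, mul_comm, one_add_one_eq_two]
  have hx : ∀ (g : Polynomial ℂ) (n : ℕ),
      (Polynomial.derivative^[n + 2] (Polynomial.X * Polynomial.derivative g - g)).eval 0
        = (n + 1) * (Polynomial.derivative^[n + 2] g).eval 0 := by
    intro g n
    rw [eval_iter, eval_iter, Polynomial.coeff_sub, Polynomial.coeff_X_mul,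
      Polynomial.coeff_derivative]
    push_cast; ring
  induction n with
  | zero =>
    intro f g f0 f1 g0 g1
    rw [eval_iter]
    simp [comulDelta, Polynomial.coeff_mul, Polynomial.coeff_derivative,
      Finset.Nat.antidiagonal_succ, f0, f1, g0, g1]
  | succ n ih =>
    intro f g f0 f1 g0 g1
    have e1 := ih (shift f) g (hs f f1).1 (hs f f1).2 g0 g1
    have e2 := ih f (shift g) f0 f1 (hs g g1).1 (hs g g1).2
    have e3 : Polynomial.derivative
          (f * Polynomial.derivative g - g * Polynomial.derivative f) =
        (shift f * Polynomial.derivative g - g * Polynomial.derivative (shift f))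
        + (f * Polynomial.derivative (shift g) - shift g * Polynomial.derivative f)
        + Polynomial.C (2 * f.coeff 2) * (Polynomial.X * Polynomial.derivative g - g)
        - Polynomial.C (2 * g.coeff 2) * (Polynomial.X * Polynomial.derivative f - f) := by
      simp only [shift, Polynomial.derivative_sub, Polynomial.derivative_mul,
        Polynomial.derivative_C, Polynomial.derivative_X]
      ring
    have e4 : ∀ f : Polynomial ℂ, tangent f (MvPolynomial.X 0) = 2 * f.coeff 2 := by
      intro f; rw [tangent_X, eval_iter]; norm_num
    rw [conv_adDeltaX, conv_adDeltaX, show n + 1 + 2 = (n + 2) + 1 from rfl,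
      Function.iterate_succ_apply, e3, Polynomial.iterate_derivative_sub,
      iter_add, iter_add,
      Polynomial.iterate_derivative_C_mul, Polynomial.iterate_derivative_C_mul]
    simp only [Polynomial.eval_add, Polynomial.eval_sub, Polynomial.eval_mul, Polynomial.eval_C, hx,
      ← e1, ← e2, e4]
    rw [tangent_X, tangent_X]
    ring

theorem conv_bracket (f g : Polynomial ℂ) (f0 : f.coeff 0 = 0) (f1 : f.coeff 1 = 0)
    (g0 : g.coeff 0 = 0) (g1 : g.coeff 1 = 0) (p : PolyDelta) :
    conv (tangent f) (tangent g) (comulHom p) - conv (tangent g) (tangent f) (comulHom p) =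
      tangent (f * Polynomial.derivative g - g * Polynomial.derivative f) p := by
  refine LinearMap.congr_fun (tangent_eq _
    (conv (tangent f) (tangent g) ∘ₗ comulHom.toLinearMap
      - conv (tangent g) (tangent f) ∘ₗ comulHom.toLinearMap) (fun p q => ?_) (fun n => ?_)) p
  · simp only [LinearMap.sub_apply, LinearMap.comp_apply, AlgHom.toLinearMap_apply, map_mul,
      conv_mul, conv_counit_left, conv_counit_right]
    ring
  · simpa using conv_comulDelta n f g f0 f1 g0 g1

/-- The form attached to `Z_{k+1}` is `P ↦ (∂P/∂δ_{k+1})(0)`. -/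
theorem tangent_vf (k : ℕ) (p : PolyDelta) :
    tangent (vf (k + 2) Polynomial.X) p = counitHom (MvPolynomial.pderiv k p) := by
  refine (LinearMap.congr_fun (tangent_eq _
    (counitHom.toLinearMap ∘ₗ ((MvPolynomial.pderiv k : Derivation ℂ PolyDelta PolyDelta) :
      PolyDelta →ₗ[ℂ] PolyDelta))
      (fun p q => ?_) (fun n => ?_)) p).symm
  · simp; ring
  · rw [eval_iter, vf, Polynomial.mkDerivation_X, Polynomial.coeff_C_mul, Polynomial.coeff_X_pow]
    rcases eq_or_ne k n with rfl | h
    · have := Nat.factorial_ne_zero (k + 2)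
      simp; field_simp
    · simp [MvPolynomial.pderiv_X_of_ne h.symm, h.symm]

theorem tangent_add (f g : Polynomial ℂ) : tangent (f + g) = tangent f + tangent g := by
  refine (tangent_eq _ _ (fun p q => ?_) fun n => ?_).symm
  · simp only [LinearMap.add_apply, tangent_mul]; ring
  · rw [LinearMap.add_apply, tangent_X, tangent_X, iter_add, Polynomial.eval_add]

theorem tangent_smul (c : ℂ) (f : Polynomial ℂ) : tangent (c • f) = c • tangent f := by
  refine (tangent_eq _ _ (fun p q => ?_) fun n => ?_).symm
  · simp only [LinearMap.smul_apply, tangent_mul, smul_eq_mul]; ring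
  · rw [LinearMap.smul_apply, tangent_X, Polynomial.iterate_derivative_smul, Polynomial.eval_smul]

/-- `𝒜¹` as a Lie algebra of linear forms on `ℋ¹`, the dual carrying the convolution product
`(S T)(P) = (S ⊗ T)(Δ P)`: the element `Z_n` is the form `P ↦ (∂P/∂δ_n)(0)`. -/
def toDual : A1 →ₗ⁅ℂ⁆ WithConv (H1 →ₗ[ℂ] ℂ) where
  toFun v := WithConv.toConv (tangent ((v : VF) Polynomial.X) : H1 →ₗ[ℂ] ℂ)
  map_add' v w := congrArg WithConv.toConv (tangent_add _ _)
  map_smul' c v := congrArg WithConv.toConv (tangent_smul _ _)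
  map_lie' {v w} := by
    have hv := Polynomial.X_pow_dvd_iff.mp v.2
    have hw := Polynomial.X_pow_dvd_iff.mp w.2
    rw [Ring.lie_def]
    refine congrArg WithConv.toConv (LinearMap.ext fun p => ?_)
    refine Eq.trans ?_ (conv_bracket _ _ (hv 0 (by norm_num)) (hv 1 (by norm_num))
      (hw 0 (by norm_num)) (hw 1 (by norm_num)) p).symm
    rw [LieSubalgebra.coe_bracket, Derivation.commutator_apply, VF.apply_eq v,
      VF.apply_eq w ((v : VF) Polynomial.X)]
    simp only [mul_comm]

/-- The algebra homomorphism from `U(𝒜¹)` to the dual algebra of `ℋ¹` extending `toDual`. -/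
def toDualHom : UA1 →ₐ[ℂ] WithConv (H1 →ₗ[ℂ] ℂ) := UniversalEnvelopingAlgebra.lift ℂ toDual

/-- The pairing `⟨P, a⟩` of `P ∈ ℋ¹` with `a ∈ U(𝒜¹)`. -/
def pairing (P : H1) (a : UA1) : ℂ := toDualHom a P

theorem pairing_one (P : H1) : pairing P 1 = Coalgebra.counit (R := ℂ) P := by
  rw [pairing, map_one]; rfl

theorem pairing_mul (P : H1) (a b : UA1) : pairing P (a * b) =
    LinearMap.mul' ℂ ℂ (TensorProduct.map (toDualHom a).ofConv (toDualHom b).ofConv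
      (Coalgebra.comul (R := ℂ) P)) := by
  rw [pairing, map_mul]; rfl

theorem pairing_vf (P : H1) (k : ℕ) (h : vf (k + 2) ∈ A1) :
    pairing P (UniversalEnvelopingAlgebra.ι ℂ (⟨vf (k + 2), h⟩ : A1)) =
      Coalgebra.counit (R := ℂ) (show H1 from MvPolynomial.pderiv k (show PolyDelta from P)) := by
  rw [pairing, toDualHom, UniversalEnvelopingAlgebra.lift_ι_apply]
  exact tangent_vf k P

/-- The generator `δ_n` of `ℋ¹`, for `n ≥ 1`. -/
def delta (n : ℕ) : H1 := (MvPolynomial.X (n - 1) : MvPolynomial ℕ ℂ)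

end

end ConnesMoscovici

namespace ConnesMoscovici

noncomputable section

attribute [local instance 100] LieRing.ofAssociativeRing

/-! Let `𝒜` act on functions `p(x) + c s` by `f ∂/∂x ↦ f ∂/∂x - f' ∂/∂s`; this is the module behind
`act` and `ev`. Then `L_0(u) = -(u·s)(0)`. Since `Z_{-1}` acts as `d/dx` and kills `s`, each bracket
with `Z_{-1}` differentiates `u·s` once, so the right-hand side is `-(d/dx)^n (a·s)(0)`
(`actHom_iterate_lie`).

It remains to see that `⟨δ_n, a⟩` is the same number. For `a = f ∂/∂x` in `𝒜¹` this is clear: `a·s =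
-f'` and the pairing is `f^(n+1)(0)`. The general case multiplies on the left by one vector field at
a time, which convolves a form `S` on `ℋ¹` with the tangent form of `f`. Two facts about `Δδ_n` make
this computable. Its right tensor factors are spanned by `1` and the `δ_i`, so only `S(1)` and the
`S(δ_i)` matter (`conv_comulDelta_congr`). Moreover, tangent forms convolve by the closed formula
`(f g'')^(n)(0)` on `δ_n` (`conv_tangent_comulDelta`). Together they say that convolution on those
values is exactly the action of `f ∂/∂x` on `p + c s` (`Represents.conv_tangent`), and
`represents_toDualHom` concludes by induction over `U(𝒜¹)`. -/

/-! ### Values of convolutions on the generators `δ_n` -/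

/-- The coproduct of `δ_n` lies in the tensor product of `ℋ¹` with the span of `1` and the `δ_i`. -/
theorem conv_comulDelta_congr (n : ℕ) : ∀ T S S' : PolyDelta →ₗ[ℂ] ℂ, S 1 = S' 1 →
    (∀ i, S (MvPolynomial.X i) = S' (MvPolynomial.X i)) →
    conv T S (comulDelta n) = conv T S' (comulDelta n) := by
  have key : ∀ (T S : PolyDelta →ₗ[ℂ] ℂ) t, conv T S (adDeltaX t) =
      conv (T ∘ₗ (adX : PolyDelta →ₗ[ℂ] PolyDelta)) S t
      + conv T (S ∘ₗ (adX : PolyDelta →ₗ[ℂ] PolyDelta)) t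
      + conv (T ∘ₗ mulDelta1) (S ∘ₗ (adY : PolyDelta →ₗ[ℂ] PolyDelta)) t := by
    intro T S t
    induction t using TensorProduct.induction_on with
    | zero => simp
    | add x y hx hy => simp only [map_add, hx, hy]; ring
    | tmul p q => simp
  induction n with
  | zero => intro T S S' h1 h; simp [comulDelta, h1, h]
  | succ n ih =>
    intro T S S' h1 h
    -- The operators `adX` and `adY` preserve the span of `1` and the `δ_i`, so `S` and `S'` still
    -- agree there after composition. Multiplication by `δ_1` leaves this span, but it only enters
    -- the left factor, where `T` is arbitrary.
    rw [comulDelta, key, key, ih _ S S' h1 h,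
      ih T (S ∘ₗ (adX : PolyDelta →ₗ[ℂ] PolyDelta)) (S' ∘ₗ (adX : PolyDelta →ₗ[ℂ] PolyDelta))
        (by simp) (by simp [h]),
      ih (T ∘ₗ mulDelta1) (S ∘ₗ (adY : PolyDelta →ₗ[ℂ] PolyDelta))
        (S' ∘ₗ (adY : PolyDelta →ₗ[ℂ] PolyDelta)) (by simp) (by simp [h])]

/-- Passing from `δ_n` to `δ_{n+1}` replaces `f` and `g` in turn by their `shift`s, which is the
product rule for `f g''` up to the subtracted term `f''(0) x`; the summand `δ_1 ⊗ Y` of `ΔX`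
restores it. Antisymmetrizing recovers the bracket, because `(f g' - g f')' = f g'' - g f''`. The
polynomial `g` is kept general so that it can be an arbitrary antiderivative. -/
theorem conv_tangent_comulDelta (n : ℕ) : ∀ f g : Polynomial ℂ,
    f.coeff 0 = 0 → f.coeff 1 = 0 →
    conv (tangent f) (tangent g) (comulDelta n) =
      (Polynomial.derivative^[n + 1]
        (f * Polynomial.derivative (Polynomial.derivative g))).eval 0 := by
  have hx : ∀ (g : Polynomial ℂ) (n : ℕ),
      (Polynomial.derivative^[n + 1]
        (Polynomial.X * Polynomial.derivative (Polynomial.derivative g))).eval 0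
        = (n + 1) * (Polynomial.derivative^[n + 2] g).eval 0 := by
    intro g n
    rw [eval_iter, eval_iter, Polynomial.coeff_X_mul, Polynomial.coeff_derivative,
      Polynomial.coeff_derivative, Nat.factorial_succ (n + 1), Nat.factorial_succ n]
    push_cast; ring
  induction n with
  | zero =>
    intro f g f0 f1
    rw [eval_iter]
    simp [comulDelta, Polynomial.coeff_mul, Finset.Nat.antidiagonal_succ, f0, f1]
  | succ n ih =>
    intro f g f0 f1
    have e1 := ih (shift f) g (by simp [shift, Polynomial.coeff_derivative, f1])
      (by simp [shift, Polynomial.coeff_derivative, mul_comm, one_add_one_eq_two])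
    have e2 := ih f (shift g) f0 f1
    -- The linear correction in `shift g` dies under the second derivative; the one in `shift f`
    -- leaves `f''(0) x g''`, whose derivative of order `n + 1` at `0` is `(n + 1) f''(0)
    -- g^(n+2)(0)`.
    have e3 : Polynomial.derivative (f * Polynomial.derivative (Polynomial.derivative g)) =
        shift f * Polynomial.derivative (Polynomial.derivative g)
        + f * Polynomial.derivative (Polynomial.derivative (shift g))
        + Polynomial.C (2 * f.coeff 2) *
          (Polynomial.X * Polynomial.derivative (Polynomial.derivative g)) := by
      rw [Polynomial.derivative_mul]
      simp only [shift, Polynomial.derivative_sub, Polynomial.derivative_C_mul,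
        Polynomial.derivative_X, mul_one, Polynomial.derivative_C]
      ring
    have e4 : tangent f (MvPolynomial.X 0) = 2 * f.coeff 2 := by
      rw [tangent_X, eval_iter]; norm_num
    rw [conv_adDeltaX, Function.iterate_succ_apply, e3, iter_add, iter_add,
      Polynomial.iterate_derivative_C_mul]
    simp only [Polynomial.eval_add, Polynomial.eval_mul, Polynomial.eval_C, hx, ← e1, ← e2, e4]
    rw [tangent_X]
    ring

/-- Needed because a tangent form reads derivatives from order `2` on, whereas `Represents` reads
them from order `1` on. -/
theorem exists_derivative_eq (g : Polynomial ℂ) : ∃ G, Polynomial.derivative G = g := by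
  induction g using Polynomial.induction_on' with
  | add p q hp hq =>
    obtain ⟨P, rfl⟩ := hp
    obtain ⟨Q, rfl⟩ := hq
    exact ⟨P + Q, map_add _ _ _⟩
  | monomial n c =>
    refine ⟨Polynomial.monomial (n + 1) (c / (n + 1)), ?_⟩
    have : (n : ℂ) + 1 ≠ 0 := Nat.cast_add_one_ne_zero n
    rw [Polynomial.derivative_monomial]
    push_cast
    rw [div_mul_cancel₀ _ this]

/-! ### Iterated brackets with `Z_{-1}` in the module -/

theorem L0_eq_ev : L0 = ev :=
  LinearMap.ext_on_range pbw_span fun a => by rw [L0_pbw, ev_pbw]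

/-- In `[Z_{-1}, u]·s = Z_{-1}·(u·s) - u·(Z_{-1}·s)` the last term vanishes, since `Z_{-1}` has
constant coefficient and so kills `s`. -/
theorem actHom_iterate_lie (n : ℕ) (u : UA) :
    (actHom ((fun u : UA => ⁅z 0, u⁆)^[n] u) (0, 1)).1 =
      Polynomial.derivative^[n] (actHom u (0, 1)).1 := by
  have hz : ∀ m : Polynomial ℂ × ℂ, actHom (z 0) m = (Polynomial.derivative m.1, 0) := by
    rintro ⟨p, c⟩
    rw [actHom_z]
    simp
  induction n with
  | zero => rfl
  | succ n ih =>
    rw [Function.iterate_succ_apply', Function.iterate_succ_apply', Ring.lie_def, map_sub, map_mul,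
      map_mul, LinearMap.sub_apply, Module.End.mul_apply, Module.End.mul_apply, hz, hz, ← ih]
    simp only [Polynomial.derivative_zero]
    rw [show ((0 : Polynomial ℂ), (0 : ℂ)) = 0 from rfl, map_zero, sub_zero]

/-! ### The pairing read off from the orbit of `s` -/

/-- For `m = (p, c)`: the linear form `S` on `ℋ¹` takes the value `c` at `1`, and its value at `δ_n`
is the negative of the derivative of order `n` of `p` at `0`. -/
def Represents (S : PolyDelta →ₗ[ℂ] ℂ) (m : Polynomial ℂ × ℂ) : Prop :=
  S 1 = m.2 ∧ ∀ n, S (MvPolynomial.X n) = -(Polynomial.derivative^[n + 1] m.1).eval 0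

theorem Represents.add {S S' : PolyDelta →ₗ[ℂ] ℂ} {m m' : Polynomial ℂ × ℂ}
    (h : Represents S m) (h' : Represents S' m') : Represents (S + S') (m + m') := by
  refine ⟨by simp [h.1, h'.1], fun n => ?_⟩
  rw [LinearMap.add_apply, h.2, h'.2, Prod.fst_add, iter_add, Polynomial.eval_add]
  ring

theorem Represents.smul {S : PolyDelta →ₗ[ℂ] ℂ} {m : Polynomial ℂ × ℂ} (c : ℂ)
    (h : Represents S m) : Represents (c • S) (c • m) := by
  refine ⟨by simp [h.1], fun n => ?_⟩
  rw [LinearMap.smul_apply, h.2, Prod.smul_fst, Polynomial.iterate_derivative_smul,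
    Polynomial.eval_smul, smul_neg]

/-- With `v = f ∂/∂x` and `G' = p`, the form `S` may be replaced by `c ε - tangent G`. On `δ_{n+1}`
the convolution is then `c f^(n+2)(0) - (f p')^(n+1)(0)`, which is minus the derivative of order `n
+ 1` of `f p' - c f'` at `0`. -/
theorem Represents.conv_tangent {S : PolyDelta →ₗ[ℂ] ℂ} {m : Polynomial ℂ × ℂ}
    (h : Represents S m) {v : VF} (hv : v ∈ A1) :
    Represents (conv (tangent (v Polynomial.X)) S ∘ₗ comulHom.toLinearMap) (act v m) := by
  have hv' := Polynomial.X_pow_dvd_iff.mp hv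
  refine ⟨?_, fun n => ?_⟩
  · change conv _ S (comulHom 1) = 0
    rw [map_one, Algebra.TensorProduct.one_def, conv_tmul, tangent_one, zero_mul]
  -- The tangent form of `G` takes the value `G^(i+2)(0) = p^(i+1)(0)` on `δ_{i+1}`; the multiple of
  -- the counit supplies the value at `1`.
  · obtain ⟨G, hG⟩ := exists_derivative_eq m.1
    have hS := conv_comulDelta_congr n (tangent (v Polynomial.X)) S
      (m.2 • counitHom.toLinearMap - tangent G) (by simp [h.1]) (fun i => by
        rw [h.2, LinearMap.sub_apply, tangent_X, Function.iterate_succ_apply _ (i + 1), hG]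
        simp)
    have hlin : ∀ (T : PolyDelta →ₗ[ℂ] ℂ) t, conv T (m.2 • counitHom.toLinearMap - tangent G) t =
        m.2 * conv T counitHom.toLinearMap t - conv T (tangent G) t := by
      intro T t
      induction t using TensorProduct.induction_on with
      | zero => simp
      | add x y hx hy => simp only [map_add, hx, hy]; ring
      | tmul p q => simp; ring
    have hc := conv_counit_right (tangent (v Polynomial.X)) (MvPolynomial.X n)
    rw [comulHom_X, tangent_X] at hc
    change conv _ S (comulHom (MvPolynomial.X n)) = -(Polynomial.derivative^[n + 1]
      (v m.1 - m.2 • Polynomial.derivative (v Polynomial.X))).eval 0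
    rw [comulHom_X, hS, hlin, hc, conv_tangent_comulDelta n _ _ (hv' 0 (by norm_num))
      (hv' 1 (by norm_num)), hG, VF.apply_eq v m.1, Polynomial.iterate_derivative_sub,
      Polynomial.iterate_derivative_smul, ← Function.iterate_succ_apply, mul_comm (v Polynomial.X)]
    simp

/-- By the universal property, the lift of `ι` into the subalgebra it generates, followed by the
inclusion, is the identity, so the inclusion is onto. -/
theorem adjoin_range_ι (R L : Type*) [CommRing R] [LieRing L] [LieAlgebra R L] :
    Algebra.adjoin R (Set.range (UniversalEnvelopingAlgebra.ι R : L → _)) = ⊤ := by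
  let S : Subalgebra R (UniversalEnvelopingAlgebra R L) :=
    Algebra.adjoin R (Set.range (UniversalEnvelopingAlgebra.ι R : L → _))
  let f : L →ₗ⁅R⁆ S :=
    { toFun := fun v => ⟨UniversalEnvelopingAlgebra.ι R v, Algebra.subset_adjoin ⟨v, rfl⟩⟩
      map_add' := fun v w => Subtype.ext (map_add (UniversalEnvelopingAlgebra.ι R) v w)
      map_smul' := fun c v => Subtype.ext (map_smul (UniversalEnvelopingAlgebra.ι R) c v)
      map_lie' := fun {v w} => Subtype.ext (LieHom.map_lie _ v w) }
  have hid : S.val.comp (UniversalEnvelopingAlgebra.lift R f) = AlgHom.id R _ := by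
    apply UniversalEnvelopingAlgebra.hom_ext
    ext v
    change S.val (UniversalEnvelopingAlgebra.lift R f (UniversalEnvelopingAlgebra.ι R v)) =
      UniversalEnvelopingAlgebra.ι R v
    rw [UniversalEnvelopingAlgebra.lift_ι_apply]
    rfl
  rw [eq_top_iff]
  intro u _
  have := AlgHom.congr_fun hid u
  rw [AlgHom.id_apply] at this
  rw [← this]
  exact (UniversalEnvelopingAlgebra.lift R f u).2

theorem represents_toDualHom (a : UA1) :
    Represents (toDualHom a).ofConv (actHom (incl a) (0, 1)) := by
  -- The unit pairs as the counit, and it fixes `s`, which has `p = 0` and `c = 1`.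
  have hone : Represents (toDualHom 1).ofConv (actHom (incl 1) (0, 1)) := by
    rw [map_one, map_one, map_one]
    refine ⟨map_one counitHom, fun n => ?_⟩
    rw [Module.End.one_apply, Polynomial.iterate_derivative_zero, Polynomial.eval_zero, neg_zero]
    exact counitHom_X n
  -- Quantifying over `b` makes the property of `a` closed under products; knowing the claim for two
  -- factors separately would not give it for their product.
  have key : ∀ a ∈ Algebra.adjoin ℂ (Set.range (UniversalEnvelopingAlgebra.ι ℂ : A1 → UA1)),
      ∀ b, Represents (toDualHom b).ofConv (actHom (incl b) (0, 1)) →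
        Represents (toDualHom (a * b)).ofConv (actHom (incl (a * b)) (0, 1)) := by
    intro a ha
    induction ha using Algebra.adjoin_induction with
    | mem a ha =>
      obtain ⟨v, rfl⟩ := ha
      intro b hb
      have h := hb.conv_tangent v.2
      have e : actHom (incl (UniversalEnvelopingAlgebra.ι ℂ v)) = act v := by
        rw [incl, UniversalEnvelopingAlgebra.lift_ι_apply, actHom]
        exact UniversalEnvelopingAlgebra.lift_ι_apply ℂ act (v : VF)
      have e' : toDualHom (UniversalEnvelopingAlgebra.ι ℂ v) = toDual v :=
        UniversalEnvelopingAlgebra.lift_ι_apply ℂ toDual v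
      rw [map_mul, map_mul, map_mul, Module.End.mul_apply, e, e']
      exact h
    | algebraMap c =>
      intro b hb
      rw [← Algebra.smul_def, map_smul, map_smul, map_smul]
      exact hb.smul c
    | add x y _ _ hx hy =>
      intro b hb
      rw [add_mul, map_add, map_add, map_add]
      exact (hx b hb).add (hy b hb)
    | mul x y _ _ hx hy =>
      intro b hb
      rw [mul_assoc]
      exact hx _ (hy b hb)
  simpa using key a (by rw [adjoin_range_ι]; trivial) 1 hone

end

end ConnesMoscovici

theorem proposition6 (n : ℕ) (hn : 1 ≤ n) (a : ConnesMoscovici.UA1) :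
    ConnesMoscovici.pairing (ConnesMoscovici.delta n) a =
      ConnesMoscovici.L0
        ((fun u : ConnesMoscovici.UA => ⁅ConnesMoscovici.z 0, u⁆)^[n] (ConnesMoscovici.incl a)) := by
  -- After this shift `δ_{n+1}` is the variable `X n`, matching the order `n + 1` in `Represents`.
  obtain ⟨n, rfl⟩ := Nat.exists_eq_add_of_le' hn
  rw [ConnesMoscovici.L0_eq_ev]
  refine ((ConnesMoscovici.represents_toDualHom a).2 n).trans ?_
  rw [← ConnesMoscovici.actHom_iterate_lie]
  rfl
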